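/- There is an absolute constant $\alpha\ge 1$ such that the following holds. Let $n,m\ge 0$ be integers, let $A\in\{0,1\}^{n\times m}$, and let $D_1,\dots,D_m$ be probability distributions on $[0,\infty)$. Then there is a threshold $\tau\ge 0$, depending only on $A$ and $D_1,\dots,D_m$, such that whenever $Y_1,\dots,Y_m$ are independent random variables with $Y_j\sim D_j$ and $X=AY$, i.e. $X_i=\sum_{j} A_{ij}Y_j$ for $1\le i\le n$, $$\mathbb{E}[\mathrm{ALG}_\tau]\;\ge\;\frac1\alpha\,\mathbb{E}\Big[\max_{1\le i\le n} X_i\Big],$$ where $\mathrm{ALG}_\tau$ denotes the reward of the fixed-threshold algorithm that observes $X_1,X_2,\dots,X_n$ in this order and takes the first $X_i$ with $X_i>\tau$; that is, $\mathrm{ALG}_\tau=X_i$ for the smallest $i$ with $X_i>\tau$, and $\mathrm{ALG}_\tau=0$ if there is no such $i$. (Expectations are taken in $[0,\infty]$, so if $\mathbb{E}[\max_i X_i]=\infty$ then $\mathbb{E}[\mathrm{ALG}_\tau]=\infty$ is asserted; the maximum over an empty set is $0$.) In other words, the unweighted linear correlations prophet problem has a fixed-threshold constant-factor approximation algorithm.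 -/

import Mathlib

open MeasureTheory ProbabilityTheory
open scoped NNReal ENNReal

namespace LinearProphet

/-- The option values `X = A · Y`, i.e. `X i = ∑ j, A i j * Y j`, in the linear correlations
model with nonnegative coefficient matrix `A` and nonnegative feature values `y`. -/
noncomputable def optionValues {n m : ℕ} (A : Matrix (Fin n) (Fin m) ℝ≥0) (y : Fin m → ℝ≥0) : Fin n → ℝ≥0 :=
  A.mulVec y

/-- The unweighted model: every entry of `A` is `0` or `1`. -/
def IsUnweighted {n m : ℕ} (A : Matrix (Fin n) (Fin m) ℝ≥0) : Prop :=
  ∀ i j, A i j = 0 ∨ A i j = 1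

/-- The reward of the prophet, `max_i x i` (equal to `0` if there are no options). -/
noncomputable def prophetReward {n : ℕ} (x : Fin n → ℝ≥0) : ℝ≥0 :=
  Finset.univ.sup x

/-- The reward of the fixed-threshold algorithm with threshold `τ` on the arrival sequence
`x 0, x 1, …`: it takes the first arrival that exceeds `τ`, and gets `0` if there is none. -/
noncomputable def fixedThresholdReward {n : ℕ} (τ : ℝ≥0) (x : Fin n → ℝ≥0) : ℝ≥0 :=
  if h : ∃ i, τ < x i then x (Fin.find (fun i => τ < x i) h) else 0

end LinearProphet

namespace LinearProphet

/-! ### Hoffmann-Jørgensen inequality for coordinate-subadditive functionals -/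

section Truncation

variable {ι : Type*} [DecidableEq ι]

/-! Let `τ` be the smallest median of `M = max X_i` and split `Y_j = min(Y_j, τ) + (Y_j - τ)⁺`. The
capped features give a maximum whose single-coordinate contributions are at most `τ`, so
Hoffmann-Jørgensen bounds its mean by `4τ`. The excesses add at most `S = ∑ E(Y_j - τ)⁺` over used
features, so `E M ≤ 4τ + S`.

Threshold `τ` earns at least `S/2` (`half_mul_sum_le`): with probability at least `1/2`,
independently of `Y_j`, the other features keep every option at most `τ`; then `Y_j > τ` forces a
stop at an option containing `j`. Threshold `τ/2` earns at least `τ/4`, since `M > τ/2` has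
probability above `1/2` when `τ > 0`. The larger of `τ` and `S` decides which threshold to use. -/

lemma measurable_piecewise_zero (S : Finset ι) :
    Measurable fun y : ι → ℝ≥0 => S.piecewise y 0 := by
  refine measurable_pi_lambda _ fun j => ?_
  by_cases h : j ∈ S
  · simpa [h] using measurable_pi_apply j
  · simp [h]

/-- Under a product measure, restrictions to disjoint sets of coordinates are independent. -/
lemma indepFun_piecewise_zero [Fintype ι] {D : ι → Measure ℝ≥0}
    [∀ j, IsProbabilityMeasure (D j)] {S T : Finset ι} (h : Disjoint S T) :
    IndepFun (fun y : ι → ℝ≥0 => S.piecewise y 0) (fun y => T.piecewise y 0)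
      (Measure.pi D) := by
  have hI : iIndepFun (fun (j : ι) (y : ι → ℝ≥0) => y j) (Measure.pi D) :=
    iIndepFun_pi (X := fun _ x => x) fun _ => aemeasurable_id
  have hST := hI.indepFun_finset S T h fun j => measurable_pi_apply j
  have key : ∀ U : Finset ι, ∃ φ : (U → ℝ≥0) → ι → ℝ≥0, Measurable φ ∧
      (fun y : ι → ℝ≥0 => U.piecewise y 0) = φ ∘ fun y (i : U) => y i := by
    intro U
    refine ⟨fun z j => if hj : j ∈ U then z ⟨j, hj⟩ else 0, ?_, ?_⟩
    · refine measurable_pi_lambda _ fun j => ?_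
      by_cases hj : j ∈ U
      · simpa [hj] using measurable_pi_apply _
      · simp [hj]
    · funext y j
      by_cases hj : j ∈ U <;> simp [hj]
  obtain ⟨φ, hφ, hφS⟩ := key S
  obtain ⟨ψ, hψ, hψT⟩ := key T
  rw [hφS, hψT]
  exact hST.comp hφ hψ

/-- A functional of nonnegative coordinates that is monotone and subadditive with respect to
restriction to sets of coordinates, and bounded by `τ` on single coordinates. -/
structure IsCoordSubadditive (τ : ℝ≥0) (F : (ι → ℝ≥0) → ℝ≥0) : Prop where
  measurable : Measurable F
  map_zero : F 0 = 0
  mono : ∀ (S : Finset ι) y, F (S.piecewise y 0) ≤ F y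
  subadd : ∀ (S T : Finset ι) y,
    F ((S ∪ T).piecewise y 0) ≤ F (S.piecewise y 0) + F (T.piecewise y 0)
  single : ∀ j y, F (({j} : Finset ι).piecewise y 0) ≤ τ

namespace IsCoordSubadditive

variable {τ : ℝ≥0} {F : (ι → ℝ≥0) → ℝ≥0}

lemma mono_subset (hF : IsCoordSubadditive τ F) {S T : Finset ι} (h : S ⊆ T) (y : ι → ℝ≥0) :
    F (S.piecewise y 0) ≤ F (T.piecewise y 0) := by
  have := hF.mono S (T.piecewise y 0)
  convert this using 2
  funext j
  by_cases hj : j ∈ S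
  · simp [hj, h hj]
  · simp [hj]

variable [Fintype ι] {D : ι → Measure ℝ≥0} [∀ j, IsProbabilityMeasure (D j)]

/-- First-passage argument: reveal coordinates one at a time. When the partial value first crosses
`t` it is at most `t + τ`, so the unrevealed coordinates, which are independent of the past, must
supply more than `s`. -/
lemma measure_inter_le (hF : IsCoordSubadditive τ F) (s t : ℝ≥0) (S : Finset ι) :
    Measure.pi D ({y | t < F (S.piecewise y 0)} ∩ {y | t + τ + s < F y}) ≤
      Measure.pi D {y | t < F (S.piecewise y 0)} * Measure.pi D {y | s < F y} := by
  induction S using Finset.induction_on with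
  | empty =>
    have : ∀ y : ι → ℝ≥0, (∅ : Finset ι).piecewise y 0 = 0 := fun y => by simp
    simp [this, hF.map_zero]
  | insert a S ha ih =>
    set μ := Measure.pi D
    set B := {y : ι → ℝ≥0 | t < F (S.piecewise y 0)}
    set E := {y : ι → ℝ≥0 | F (S.piecewise y 0) ≤ t} ∩ {y | t < F ((insert a S).piecewise y 0)}
    set G := {y : ι → ℝ≥0 | t + τ + s < F y}
    set H := {y : ι → ℝ≥0 | s < F (((insert a S)ᶜ).piecewise y 0)}
    have hm : ∀ U : Finset ι, Measurable fun y : ι → ℝ≥0 => F (U.piecewise y 0) := fun U =>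
      hF.measurable.comp (measurable_piecewise_zero U)
    have hB : MeasurableSet B := measurableSet_lt measurable_const (hm S)
    have hE : MeasurableSet E :=
      (measurableSet_le (hm S) measurable_const).inter (measurableSet_lt measurable_const (hm _))
    have hsplit : {y : ι → ℝ≥0 | t < F ((insert a S).piecewise y 0)} = B ∪ E := by
      ext y
      have := hF.mono_subset (Finset.subset_insert a S) y
      simp only [B, E, Set.mem_ofPred_eq, Set.mem_union, Set.mem_inter_iff]
      constructor
      · intro h
        rcases lt_or_ge t (F (S.piecewise y 0)) with h' | h'
        · exact Or.inl h'
        · exact Or.inr ⟨h', h⟩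
      · rintro (h | h)
        · exact h.trans_le this
        · exact h.2
    have hdisj : Disjoint B E := by
      rw [Set.disjoint_left]
      intro y (hy : t < F (S.piecewise y 0)) hy'
      exact absurd hy (not_lt.2 hy'.1)
    have hsub : E ∩ G ⊆ E ∩ H := by
      rintro y ⟨hyE, hyG⟩
      refine ⟨hyE, ?_⟩
      have h1 := hF.subadd (insert a S) (insert a S)ᶜ y
      have h2 := hF.subadd {a} S y
      rw [Finset.union_compl, Finset.piecewise_univ] at h1
      rw [← Finset.insert_eq] at h2
      have h3 := hF.single a y
      have h4 := hyE.1
      simp only [G, Set.mem_ofPred_eq] at hyG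
      simp only [H, Set.mem_ofPred_eq]
      by_contra! h5
      refine absurd hyG (not_lt.2 ?_)
      calc F y ≤ _ := h1
        _ ≤ (τ + t) + s := add_le_add (h2.trans (add_le_add h3 h4)) h5
        _ = t + τ + s := by ring
    have hind : μ (E ∩ H) = μ E * μ H := by
      have hi := (indepFun_piecewise_zero (D := D)
        (disjoint_compl_right (a := insert a S))).measure_inter_preimage_eq_mul
          ({z | F (S.piecewise z 0) ≤ t} ∩ {z | t < F z}) {z | s < F z}
          ((measurableSet_le (hm S) measurable_const).inter
            (measurableSet_lt measurable_const hF.measurable))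
          (measurableSet_lt measurable_const hF.measurable)
      -- The crossing event `E` depends only on the coordinates in `insert a S`, while `H` depends
      -- on the complement.
      have e : (fun y : ι → ℝ≥0 => (insert a S).piecewise y 0) ⁻¹'
          ({z | F (S.piecewise z 0) ≤ t} ∩ {z | t < F z}) = E := by
        ext y
        have : S.piecewise ((insert a S).piecewise y 0) 0 = S.piecewise y 0 := by
          funext j
          by_cases hj : j ∈ S <;> simp [hj]
        simp only [Set.mem_preimage, Set.mem_inter_iff, Set.mem_ofPred_eq, this, E]
      rw [e] at hi
      exact hi
    have hH : μ H ≤ μ {y | s < F y} := measure_mono fun y hy => lt_of_lt_of_le hy (hF.mono _ y)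
    rw [hsplit, Set.union_inter_distrib_right]
    calc μ (B ∩ G ∪ E ∩ G) ≤ μ (B ∩ G) + μ (E ∩ G) := measure_union_le _ _
      _ ≤ μ B * μ {y | s < F y} + μ E * μ {y | s < F y} := by
        refine add_le_add ih ((measure_mono hsub).trans ?_)
        rw [hind]
        gcongr
      _ = μ (B ∪ E) * μ {y | s < F y} := by rw [measure_union hdisj hE, add_mul]

/-- The Hoffmann-Jørgensen inequality. -/
lemma measure_lt_le_mul (hF : IsCoordSubadditive τ F) (s t : ℝ≥0) :
    Measure.pi D {y | t + τ + s < F y} ≤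
      Measure.pi D {y | t < F y} * Measure.pi D {y | s < F y} := by
  have h := hF.measure_inter_le (D := D) s t Finset.univ
  simp only [Finset.piecewise_univ] at h
  refine le_trans (measure_mono ?_) h
  intro y hy
  have hy' : t + τ + s < F y := hy
  refine ⟨show t < F y from lt_of_le_of_lt ?_ hy', hy⟩
  rw [add_assoc]
  exact le_self_add

/-- Integrating the tail inequality with `s = τ` over `t` gives `E(F - 2τ)⁺ ≤ E F / 2`, hence `E F ≤
2τ + E F / 2`; finiteness allows absorbing the last term. -/
lemma lintegral_le (hF : IsCoordSubadditive τ F) (hmed : Measure.pi D {y | τ < F y} ≤ 1 / 2)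
    (hfin : ∫⁻ y, F y ∂Measure.pi D ≠ ∞) :
    ∫⁻ y, F y ∂Measure.pi D ≤ 4 * τ := by
  set μ := Measure.pi D
  have hlc : ∀ G : (ι → ℝ≥0) → ℝ≥0, Measurable G →
      ∫⁻ y, G y ∂μ = ∫⁻ t in Set.Ioi (0 : ℝ), μ {y | t < (G y : ℝ)} := by
    intro G hG
    have h := lintegral_eq_lintegral_meas_lt μ (f := fun y => (G y : ℝ))
      (Filter.Eventually.of_forall fun y => (G y).2) hG.coe_nnreal_real.aemeasurable
    simpa only [ENNReal.ofReal_coe_nnreal] using h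
  have hsub : ∫⁻ y, ((F y - 2 * τ : ℝ≥0) : ℝ≥0∞) ∂μ ≤ 1 / 2 * ∫⁻ y, F y ∂μ := by
    rw [hlc _ (hF.measurable.sub_const _), hlc _ hF.measurable,
      ← lintegral_const_mul' _ _ (by simp)]
    refine setLIntegral_mono' measurableSet_Ioi fun t ht => ?_
    lift t to ℝ≥0 using le_of_lt ht
    simp only [NNReal.coe_lt_coe, lt_tsub_iff_right]
    calc μ {y | t + 2 * τ < F y} = μ {y | t + τ + τ < F y} := by
          congr 1; ext y; rw [two_mul, add_assoc]
      _ ≤ μ {y | t < F y} * μ {y | τ < F y} := hF.measure_lt_le_mul τ t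
      _ ≤ μ {y | t < F y} * (1 / 2) := by gcongr
      _ = _ := mul_comm _ _
  have hle : ∫⁻ y, F y ∂μ ≤ 2 * τ + 1 / 2 * ∫⁻ y, F y ∂μ := by
    calc ∫⁻ y, F y ∂μ ≤ ∫⁻ y, (2 * (τ : ℝ≥0∞) + ((F y - 2 * τ : ℝ≥0) : ℝ≥0∞)) ∂μ := by
          refine lintegral_mono fun y => ?_
          have h : F y ≤ 2 * τ + (F y - 2 * τ) := le_add_tsub
          simpa only [ENNReal.coe_add, ENNReal.coe_mul, ENNReal.coe_ofNat]
            using ENNReal.coe_le_coe.2 h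
      _ = 2 * τ + ∫⁻ y, ((F y - 2 * τ : ℝ≥0) : ℝ≥0∞) ∂μ := by
          rw [lintegral_add_left measurable_const]; simp
      _ ≤ _ := by gcongr
  lift (∫⁻ y, F y ∂μ) to ℝ≥0 using hfin with I
  have h2 : I ≤ 2 * τ + 1 / 2 * I := by
    have : ((2 * τ + 1 / 2 * I : ℝ≥0) : ℝ≥0∞) = 2 * τ + 1 / 2 * I := by
      push_cast
      simp
    rw [← this] at hle
    exact_mod_cast hle
  have h3 : I ≤ 4 * τ := by
    have : (I : ℝ) ≤ 2 * τ + 1 / 2 * I := by exact_mod_cast h2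
    have : (I : ℝ) ≤ 4 * τ := by linarith
    exact_mod_cast this
  exact_mod_cast h3

end IsCoordSubadditive

end Truncation

/-- A (smallest) median of a nonnegative random variable. -/
lemma exists_median {Ω : Type*} [MeasurableSpace Ω] (μ : Measure Ω) [IsProbabilityMeasure μ]
    {M : Ω → ℝ≥0} (hM : Measurable M) :
    ∃ τ : ℝ≥0, μ {ω | τ < M ω} ≤ 1 / 2 ∧ ∀ t < τ, 1 / 2 < μ {ω | t < M ω} := by
  set T := {t : ℝ≥0 | μ {ω | t < M ω} ≤ 1 / 2}
  have hT : T.Nonempty := by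
    have hlim := tendsto_measure_iInter_atTop (μ := μ) (s := fun k : ℕ => {ω | (k : ℝ≥0) < M ω})
      (fun k => (measurableSet_lt measurable_const hM).nullMeasurableSet)
      (fun k l hkl ω (hω : (l : ℝ≥0) < M ω) =>
        show (k : ℝ≥0) < M ω from lt_of_le_of_lt (Nat.cast_le.2 hkl) hω) ⟨0, measure_ne_top _ _⟩
    have hempty : ⋂ k : ℕ, {ω | (k : ℝ≥0) < M ω} = ∅ := by
      ext ω
      obtain ⟨k, hk⟩ := exists_nat_ge (M ω)
      simp only [Set.mem_iInter, Set.mem_ofPred_eq, Set.mem_empty_iff_false, iff_false, not_forall,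
        not_lt]
      exact ⟨k, hk⟩
    rw [hempty, measure_empty] at hlim
    obtain ⟨k, hk⟩ := (hlim.eventually_lt_const (show (0 : ℝ≥0∞) < 1 / 2 by simp)).exists
    exact ⟨k, hk.le⟩
  refine ⟨sInf T, ?_, fun t ht => ?_⟩
  -- Right-continuity of the tail: the infimum of `T` belongs to `T`.
  · have hU : {ω | sInf T < M ω} = ⋃ k : ℕ, {ω | sInf T + 1 / ((k : ℝ≥0) + 1) < M ω} := by
      ext ω
      simp only [Set.mem_ofPred_eq, Set.mem_iUnion]
      constructor
      · intro h
        obtain ⟨k, hk⟩ := exists_nat_one_div_lt (tsub_pos_of_lt h)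
        exact ⟨k, by rwa [add_comm, ← lt_tsub_iff_right]⟩
      · rintro ⟨k, hk⟩
        exact lt_of_le_of_lt le_self_add hk
    have hmono : Monotone fun k : ℕ => {ω | sInf T + 1 / ((k : ℝ≥0) + 1) < M ω} := by
      intro k l hkl ω hω
      change _ < M ω at hω
      change _ < M ω
      refine lt_of_le_of_lt ?_ hω
      gcongr
    rw [hU, hmono.measure_iUnion]
    refine iSup_le fun k => ?_
    obtain ⟨t, ht, htk⟩ := exists_lt_of_csInf_lt hT
      (lt_add_of_pos_right (sInf T) (show 0 < 1 / ((k : ℝ≥0) + 1) by positivity))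
    exact le_trans (measure_mono fun ω hω => htk.trans hω) ht
  · by_contra! h
    have hle : sInf T ≤ t := csInf_le (OrderBot.bddBelow T) h
    exact absurd hle (not_le.2 ht)

/-! ### Pathwise bounds on the prophet and the algorithm -/

variable {n m : ℕ} {A : Matrix (Fin n) (Fin m) ℝ≥0}

lemma optionValues_apply (A : Matrix (Fin n) (Fin m) ℝ≥0) (y : Fin m → ℝ≥0) (i : Fin n) :
    optionValues A y i = ∑ j, A i j * y j := rfl

lemma optionValues_le_prophetReward (A : Matrix (Fin n) (Fin m) ℝ≥0) (y : Fin m → ℝ≥0)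
    (i : Fin n) : optionValues A y i ≤ prophetReward (optionValues A y) :=
  Finset.le_sup (Finset.mem_univ i)

lemma prophetReward_le {x : Fin n → ℝ≥0} {c : ℝ≥0} (h : ∀ i, x i ≤ c) : prophetReward x ≤ c :=
  Finset.sup_le fun i _ => h i

lemma prophetReward_optionValues_mono {y z : Fin m → ℝ≥0} (h : y ≤ z) :
    prophetReward (optionValues A y) ≤ prophetReward (optionValues A z) := by
  refine prophetReward_le fun i => le_trans ?_ (optionValues_le_prophetReward A z i)
  simp only [optionValues_apply]
  gcongr with j
  exact h j

lemma measurable_prophetReward_optionValues :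
    Measurable fun y => prophetReward (optionValues A y) := by
  have h : ∀ s : Finset (Fin n), Measurable fun y => s.sup (optionValues A y) := by
    intro s
    induction s using Finset.induction_on with
    | empty => simp
    | insert a s ha ih =>
      simp only [Finset.sup_insert]
      refine Measurable.sup ?_ ih
      simp only [optionValues_apply]
      fun_prop
  exact h Finset.univ

lemma IsUnweighted.le_one (hA : IsUnweighted A) (i : Fin n) (j : Fin m) : A i j ≤ 1 := by
  rcases hA i j with h | h <;> simp [h]

lemma IsUnweighted.isCoordSubadditive_truncate (hA : IsUnweighted A) (τ : ℝ≥0) :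
    IsCoordSubadditive τ fun y : Fin m → ℝ≥0 =>
      prophetReward (optionValues A fun j => min (y j) τ) where
  measurable := measurable_prophetReward_optionValues.comp
    (measurable_pi_lambda _ fun j => (measurable_pi_apply j).min measurable_const)
  map_zero := by
    refine le_antisymm (prophetReward_le fun i => ?_) zero_le
    simp [optionValues_apply]
  mono S y := by
    refine prophetReward_optionValues_mono fun j => ?_
    by_cases h : j ∈ S <;> simp [h]
  subadd S T y := by
    refine prophetReward_le fun i => le_trans ?_ (add_le_add
      (optionValues_le_prophetReward A _ i) (optionValues_le_prophetReward A _ i))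
    simp only [optionValues_apply]
    rw [← Finset.sum_add_distrib]
    refine Finset.sum_le_sum fun j _ => ?_
    by_cases h : j ∈ S <;> by_cases h' : j ∈ T <;> simp [h, h']
  single k y := by
    refine prophetReward_le fun i => ?_
    rw [optionValues_apply, Finset.sum_eq_single k]
    · calc A i k * min ((({k} : Finset (Fin m)).piecewise y 0) k) τ ≤ 1 * τ :=
          mul_le_mul' (hA.le_one i k) (min_le_right _ _)
        _ = τ := one_mul τ
    · intro j _ hj
      simp [hj]
    · simp

/-- The features that contribute to some option. -/
noncomputable def usedFeatures (A : Matrix (Fin n) (Fin m) ℝ≥0) : Finset (Fin m) :=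
  open Classical in Finset.univ.filter fun j => ∃ i, A i j = 1

lemma mem_usedFeatures {j : Fin m} : j ∈ usedFeatures A ↔ ∃ i, A i j = 1 := by
  classical
  simp [usedFeatures]

lemma IsUnweighted.prophetReward_le_truncate_add (hA : IsUnweighted A) (τ : ℝ≥0)
    (y : Fin m → ℝ≥0) :
    prophetReward (optionValues A y) ≤
      prophetReward (optionValues A fun j => min (y j) τ) + ∑ j ∈ usedFeatures A, (y j - τ) := by
  refine prophetReward_le fun i => ?_
  refine le_trans ?_ (add_le_add_left (optionValues_le_prophetReward A _ i) _)
  have h : ∑ j, A i j * (y j - τ) ≤ ∑ j ∈ usedFeatures A, (y j - τ) := by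
    rw [← Finset.sum_subset (Finset.subset_univ (usedFeatures A))]
    · exact Finset.sum_le_sum fun j _ => mul_le_of_le_one_left zero_le (hA.le_one i j)
    · intro j _ hj
      rcases hA i j with h | h
      · simp [h]
      · exact absurd (mem_usedFeatures.2 ⟨i, h⟩) hj
  refine le_trans (le_of_eq ?_) (add_le_add_right h _)
  simp only [optionValues_apply]
  rw [← Finset.sum_add_distrib]
  refine Finset.sum_congr rfl fun j _ => ?_
  rw [← mul_add, add_comm, tsub_add_min]

lemma le_optionValues {i : Fin n} {j : Fin m} (h : A i j = 1) (y : Fin m → ℝ≥0) :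
    y j ≤ optionValues A y i := by
  rw [optionValues_apply]
  calc y j = A i j * y j := by rw [h, one_mul]
    _ ≤ _ := Finset.single_le_sum (f := fun j => A i j * y j) (fun _ _ => zero_le)
      (Finset.mem_univ j)

lemma lt_prophetReward_iff {τ : ℝ≥0} {x : Fin n → ℝ≥0} : τ < prophetReward x ↔ ∃ i, τ < x i := by
  simp [prophetReward, Finset.lt_sup_iff]

lemma le_fixedThresholdReward {τ : ℝ≥0} {x : Fin n → ℝ≥0} {c : ℝ≥0} (h : ∃ i, τ < x i)
    (hc : ∀ i, τ < x i → c ≤ x i) : c ≤ fixedThresholdReward τ x := by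
  rw [fixedThresholdReward, dif_pos h]
  exact hc _ (Fin.find_spec h)

/-- If all features but `j` keep every option below the threshold while `Y j` exceeds it, the
algorithm stops at an option that contains `j`. -/
lemma IsUnweighted.le_fixedThresholdReward_of_dominant (hA : IsUnweighted A) {τ : ℝ≥0}
    {y : Fin m → ℝ≥0} {j : Fin m} (hj : j ∈ usedFeatures A) (hτ : τ < y j)
    (h : prophetReward (optionValues A (({j}ᶜ : Finset (Fin m)).piecewise y 0)) ≤ τ) :
    y j ≤ fixedThresholdReward τ (optionValues A y) := by
  obtain ⟨i₀, hi₀⟩ := mem_usedFeatures.1 hj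
  refine le_fixedThresholdReward ⟨i₀, hτ.trans_le (le_optionValues hi₀ y)⟩ fun i hi => ?_
  rcases hA i j with h0 | h1
  · exfalso
    -- An option without `j` keeps its value when `y j` is zeroed, so it cannot exceed `τ`.
    refine absurd ((optionValues_le_prophetReward A _ i).trans h) (not_le.2 (hi.trans_le ?_))
    refine le_of_eq ?_
    simp only [optionValues_apply]
    refine Finset.sum_congr rfl fun k _ => ?_
    by_cases hk : k = j
    · simp [hk, h0]
    · simp [hk]
  · exact le_optionValues h1 y

/-- At most one summand is nonzero: if the features other than `j` keep all options at most `τ`,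
every other used feature is itself at most `τ`. -/
lemma IsUnweighted.sum_dominant_le (hA : IsUnweighted A) (τ : ℝ≥0) (y : Fin m → ℝ≥0) :
    ∑ j ∈ usedFeatures A, (y j - τ) *
        (if prophetReward (optionValues A (({j}ᶜ : Finset (Fin m)).piecewise y 0)) ≤ τ
          then 1 else 0) ≤
      fixedThresholdReward τ (optionValues A y) := by
  by_cases hex : ∃ j ∈ usedFeatures A, τ < y j ∧
      prophetReward (optionValues A (({j}ᶜ : Finset (Fin m)).piecewise y 0)) ≤ τ
  · obtain ⟨j, hj, hτ, hle⟩ := hex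
    rw [Finset.sum_eq_single j]
    · rw [if_pos hle, mul_one]
      exact tsub_le_self.trans (hA.le_fixedThresholdReward_of_dominant hj hτ hle)
    · intro k hk hkj
      obtain ⟨i, hi⟩ := mem_usedFeatures.1 hk
      have : y k ≤ τ := by
        refine le_trans ?_ ((optionValues_le_prophetReward A _ i).trans hle)
        refine le_trans ?_ (le_optionValues hi _)
        simp [hkj]
      simp [tsub_eq_zero_of_le this]
    · exact fun h => absurd hj h
  · push Not at hex
    rw [Finset.sum_eq_zero]
    · exact zero_le
    · intro j hj
      split_ifs with hle
      · have : y j ≤ τ := by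
          by_contra! hlt
          exact absurd hle (not_le.2 (hex j hj hlt))
        simp [tsub_eq_zero_of_le this]
      · simp

/-! ### Expected rewards and the choice of threshold -/

section Expectation

variable {D : Fin m → Measure ℝ≥0} [∀ j, IsProbabilityMeasure (D j)]

lemma half_le_measure_le {Ω : Type*} [MeasurableSpace Ω] {μ : Measure Ω} [IsProbabilityMeasure μ]
    {M : Ω → ℝ≥0} (hM : Measurable M) {τ : ℝ≥0} (h : μ {ω | τ < M ω} ≤ 1 / 2) :
    1 / 2 ≤ μ {ω | M ω ≤ τ} := by
  have hc : {ω | M ω ≤ τ} = {ω | τ < M ω}ᶜ := by ext ω; simp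
  rw [hc, prob_compl_eq_one_sub (measurableSet_lt measurable_const hM)]
  calc (1 / 2 : ℝ≥0∞) = 1 - 1 / 2 := by simp
    _ ≤ _ := tsub_le_tsub_left h 1

lemma IsUnweighted.half_mul_sum_le (hA : IsUnweighted A) {τ : ℝ≥0}
    (hmed : Measure.pi D {y | τ < prophetReward (optionValues A y)} ≤ 1 / 2) :
    1 / 2 * ∑ j ∈ usedFeatures A, ∫⁻ y, ((y j - τ : ℝ≥0) : ℝ≥0∞) ∂Measure.pi D ≤
      ∫⁻ y, fixedThresholdReward τ (optionValues A y) ∂Measure.pi D := by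
  classical
  set μ := Measure.pi D
  set Q : Fin m → Set (Fin m → ℝ≥0) := fun j =>
    {z | prophetReward (optionValues A (({j}ᶜ : Finset (Fin m)).piecewise z 0)) ≤ τ}
  have hQ : ∀ j, MeasurableSet (Q j) := fun j => measurableSet_le
    (measurable_prophetReward_optionValues.comp (measurable_piecewise_zero _)) measurable_const
  have hmeas : ∀ j, Measurable fun y : Fin m → ℝ≥0 => ((y j - τ : ℝ≥0) : ℝ≥0∞) := fun j =>
    ((measurable_id.sub_const τ).comp (measurable_pi_apply j)).coe_nnreal_ennreal
  have hterm : ∀ j, 1 / 2 * ∫⁻ y, ((y j - τ : ℝ≥0) : ℝ≥0∞) ∂μ ≤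
      ∫⁻ y, ((y j - τ : ℝ≥0) : ℝ≥0∞) * (Q j).indicator 1 y ∂μ := by
    intro j
    have hind : IndepFun (fun y : Fin m → ℝ≥0 => ((y j - τ : ℝ≥0) : ℝ≥0∞))
        ((Q j).indicator (1 : (Fin m → ℝ≥0) → ℝ≥0∞)) μ := by
      have h := (indepFun_piecewise_zero (D := D)
        (disjoint_compl_right (a := ({j} : Finset (Fin m))))).comp (hmeas j)
          (ψ := {z | prophetReward (optionValues A z) ≤ τ}.indicator (1 : (Fin m → ℝ≥0) → ℝ≥0∞))
          (measurable_one.indicator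
            (measurableSet_le measurable_prophetReward_optionValues measurable_const))
      convert h using 1
      · funext y
        simp
      · funext y
        simp [Set.indicator_apply, Q]
    rw [lintegral_mul_eq_lintegral_mul_lintegral_of_indepFun'' (hmeas j).aemeasurable
      (measurable_one.indicator (hQ j)).aemeasurable hind, mul_comm, lintegral_indicator_one (hQ j)]
    gcongr
    -- Deleting feature `j` only lowers the maximum, so `Q j` contains the event that the full
    -- maximum is at most `τ`.
    refine (half_le_measure_le measurable_prophetReward_optionValues hmed).trans
      (measure_mono fun y hy => ?_)
    refine le_trans (prophetReward_optionValues_mono fun k => ?_) hy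
    by_cases hk : k = j <;> simp [hk]
  rw [Finset.mul_sum]
  calc _ ≤ ∑ j ∈ usedFeatures A, ∫⁻ y, ((y j - τ : ℝ≥0) : ℝ≥0∞) * (Q j).indicator 1 y ∂μ :=
        Finset.sum_le_sum fun j _ => hterm j
    _ = ∫⁻ y, ∑ j ∈ usedFeatures A, ((y j - τ : ℝ≥0) : ℝ≥0∞) * (Q j).indicator 1 y ∂μ :=
        (lintegral_finsetSum _ fun j _ =>
          (hmeas j).mul (measurable_one.indicator (hQ j))).symm
    _ ≤ _ := by
        refine lintegral_mono fun y => ?_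
        have h := ENNReal.coe_le_coe.2 (hA.sum_dominant_le τ y)
        refine le_trans (le_of_eq ?_) h
        push_cast
        refine Finset.sum_congr rfl fun j _ => ?_
        split_ifs with hj <;> simp [Q, hj]

lemma IsUnweighted.lintegral_prophetReward_le (hA : IsUnweighted A) {τ : ℝ≥0}
    (hmed : Measure.pi D {y | τ < prophetReward (optionValues A y)} ≤ 1 / 2) :
    ∫⁻ y, prophetReward (optionValues A y) ∂Measure.pi D ≤
      4 * τ + ∑ j ∈ usedFeatures A, ∫⁻ y, ((y j - τ : ℝ≥0) : ℝ≥0∞) ∂Measure.pi D := by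
  set μ := Measure.pi D
  have hF := hA.isCoordSubadditive_truncate τ
  have hcore : ∫⁻ y, prophetReward (optionValues A fun j => min (y j) τ) ∂μ ≤ 4 * τ := by
    refine hF.lintegral_le ((measure_mono fun y hy => ?_).trans hmed) ?_
    · exact lt_of_lt_of_le hy (prophetReward_optionValues_mono fun j => min_le_left _ _)
    · refine ne_top_of_le_ne_top (b := ((prophetReward (optionValues A fun _ => τ) : ℝ≥0) : ℝ≥0∞))
        ENNReal.coe_ne_top ?_
      calc _ ≤ ∫⁻ _, ((prophetReward (optionValues A fun _ => τ) : ℝ≥0) : ℝ≥0∞) ∂μ :=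
            lintegral_mono fun y => ENNReal.coe_le_coe.2
              (prophetReward_optionValues_mono fun j => min_le_right _ _)
        _ = _ := by simp
  calc _ ≤ ∫⁻ y, ((prophetReward (optionValues A fun j => min (y j) τ) : ℝ≥0∞) +
          ∑ j ∈ usedFeatures A, ((y j - τ : ℝ≥0) : ℝ≥0∞)) ∂μ := by
        refine lintegral_mono fun y => ?_
        simpa only [ENNReal.coe_add, ENNReal.ofNNReal_finsetSum]
          using ENNReal.coe_le_coe.2 (hA.prophetReward_le_truncate_add τ y)
    _ = ∫⁻ y, prophetReward (optionValues A fun j => min (y j) τ) ∂μ +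
          ∑ j ∈ usedFeatures A, ∫⁻ y, ((y j - τ : ℝ≥0) : ℝ≥0∞) ∂μ := by
        rw [lintegral_add_left hF.measurable.coe_nnreal_ennreal, lintegral_finsetSum]
        exact fun j _ => ((measurable_id.sub_const τ).comp (measurable_pi_apply j)).coe_nnreal_ennreal
    _ ≤ _ := by gcongr

lemma mul_measure_le_lintegral_fixedThresholdReward {Ω : Type*} [MeasurableSpace Ω]
    (μ : Measure Ω) {X : Ω → Fin n → ℝ≥0} (hX : Measurable fun ω => prophetReward (X ω))
    (τ : ℝ≥0) :
    τ * μ {ω | τ < prophetReward (X ω)} ≤ ∫⁻ ω, fixedThresholdReward τ (X ω) ∂μ := by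
  rw [← lintegral_indicator_const (measurableSet_lt measurable_const hX)]
  refine lintegral_mono (Set.indicator_le fun ω hω => ?_)
  exact ENNReal.coe_le_coe.2
    (le_fixedThresholdReward (lt_prophetReward_iff.1 hω) fun i hi => hi.le)

lemma IsUnweighted.exists_threshold (hA : IsUnweighted A) :
    ∃ τ : ℝ≥0, ∫⁻ y, prophetReward (optionValues A y) ∂Measure.pi D ≤
      20 * ∫⁻ y, fixedThresholdReward τ (optionValues A y) ∂Measure.pi D := by
  obtain ⟨τ, hmed, hlow⟩ := exists_median (Measure.pi D)
    (measurable_prophetReward_optionValues (A := A))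
  set μ := Measure.pi D
  have hup := hA.lintegral_prophetReward_le hmed
  have hlo := hA.half_mul_sum_le hmed
  set S := ∑ j ∈ usedFeatures A, ∫⁻ y, ((y j - τ : ℝ≥0) : ℝ≥0∞) ∂μ
  -- The first case includes `S = ∞`, hence any infinite prophet value.
  rcases le_or_gt (τ : ℝ≥0∞) S with hS | hS
  · refine ⟨τ, hup.trans ?_⟩
    calc 4 * (τ : ℝ≥0∞) + S ≤ 4 * S + S := by gcongr
      _ = 10 * (1 / 2 * S) := by
        have h : (10 : ℝ≥0∞) * (1 / 2) = 5 := by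
          rw [show (10 : ℝ≥0∞) = 5 * 2 by norm_num, mul_assoc, one_div,
            ENNReal.mul_inv_cancel (by simp) (by simp), mul_one]
        rw [← mul_assoc, h]; ring
      _ ≤ 20 * (1 / 2 * S) := by gcongr; norm_num
      _ ≤ _ := by gcongr
  · have hτ : 0 < τ := by
      rcases eq_or_ne τ 0 with h | h
      · simp [h] at hS
      · exact pos_iff_ne_zero.2 h
    -- `τ` itself may fail, as when the maximum is constantly `τ`; any value strictly below the
    -- smallest median is exceeded with probability above `1/2`. The constant is `5τ = 20 · (τ/2) ·
    -- (1/2)`.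
    refine ⟨τ / 2, hup.trans ?_⟩
    have hM := mul_measure_le_lintegral_fixedThresholdReward μ
      (measurable_prophetReward_optionValues (A := A)) (τ / 2)
    have hhalf := (hlow (τ / 2) (half_lt_self hτ)).le
    calc 4 * (τ : ℝ≥0∞) + S ≤ 4 * τ + τ := by gcongr
      _ = 20 * (((τ / 2 : ℝ≥0) : ℝ≥0∞) * (1 / 2)) := by
        have h : 4 * τ + τ = 20 * ((τ / 2) * (1 / 2)) := by
          rw [← NNReal.coe_inj]; push_cast; ring
        have h' := congrArg ((↑) : ℝ≥0 → ℝ≥0∞) h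
        push_cast at h'
        simpa using h'
      _ ≤ _ := by gcongr; exact (mul_le_mul_right hhalf _).trans hM

end Expectation

end LinearProphet

theorem mainTheorem9 :
    ∃ α : ℝ≥0, 1 ≤ α ∧
      ∀ (n m : ℕ) (A : Matrix (Fin n) (Fin m) ℝ≥0) (D : Fin m → Measure ℝ≥0)
        [∀ j, IsProbabilityMeasure (D j)],
        LinearProphet.IsUnweighted A →
        ∃ τ : ℝ≥0,
          ∀ {Ω : Type*} [MeasurableSpace Ω] (P : Measure Ω) [IsProbabilityMeasure P]
            (Y : Fin m → Ω → ℝ≥0),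
            (∀ j, HasLaw (Y j) (D j) P) → iIndepFun Y P →
            (1 / (α : ℝ≥0∞)) *
                ∫⁻ ω, (LinearProphet.prophetReward
                  (LinearProphet.optionValues A fun j => Y j ω) : ℝ≥0∞) ∂P ≤
              ∫⁻ ω, (LinearProphet.fixedThresholdReward τ
                (LinearProphet.optionValues A fun j => Y j ω) : ℝ≥0∞) ∂P := by
  refine ⟨20, by norm_num, fun n m A D _ hA => ?_⟩
  obtain ⟨τ, hτ⟩ := hA.exists_threshold (D := D)
  refine ⟨τ, fun P _ Y hY hind => ?_⟩
  have hmeas : ∀ j, AEMeasurable (Y j) P := fun j => (hY j).aemeasurable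
  have hmap : P.map (fun ω j => Y j ω) = Measure.pi D := by
    rw [(iIndepFun_iff_map_fun_eq_pi_map hmeas).1 hind]
    congr 1
    funext j
    exact (hY j).map_eq
  rw [← hmap, lintegral_map'
    LinearProphet.measurable_prophetReward_optionValues.coe_nnreal_ennreal.aemeasurable
    (aemeasurable_pi_lambda _ hmeas)] at hτ
  -- For the algorithm's reward only one direction of the change of variables is needed, so its
  -- measurability is not.
  have hτ' := hτ.trans (mul_le_mul_right (lintegral_map_le _ _) 20)
  rw [one_div, mul_comm, ← div_eq_mul_inv]
  exact ENNReal.div_le_of_le_mul' (by simpa using hτ')
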